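/- Let $A$ be a Dedekind domain which is not a field, and let $\mathrm{fgMod}(A)$ be the category of finitely generated $A$-modules. Consider the full subcategories $\mathcal{A}$ of $\mathrm{fgMod}(A)$ that are replete (closed under isomorphism), reflective (the inclusion $\mathcal{A}\hookrightarrow\mathrm{fgMod}(A)$ has a left adjoint), and contain all finitely generated free $A$-modules, partially ordered by inclusion. This partially ordered set is isomorphic to the set of functions $$\mathrm{MaxSpec}(A)\to\{0,1,2,\dots,\infty\}$$ on the set of maximal ideals of $A$, ordered by $f\le g$ if and only if $f(\mathfrak m)\le g(\mathfrak m)$ for all $\mathfrak m$. More precisely, there is an isomorphism $\mathcal{A}\mapsto f_{\mathcal{A}}$ of partially ordered sets with the following properties. 1. $f_{\mathcal{A}}(\mathfrak m)$ is the largest integer $n\ge 0$ such that $A/\mathfrak m^n$ lies in $\mathcal{A}$ if there is a largest one, and $f_{\mathcal{A}}(\mathfrak m)=\infty$ if and only if $A/\mathfrak m^n$ lies in $\mathcal{A}$ for all $n$. 2. The subcategory $\mathcal{A}_f$ corresponding to $f$ consists of those finitely generated $A$-modules $M$ such that, for every maximal ideal $\mathfrak m$ and every $n\ge 0$, if there is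 a monomorphism $A/\mathfrak m^n\to M$, then $n\le f(\mathfrak m)$. 3. For a finitely generated $A$-module $M$, let $u_f(M)\subseteq M$ be the submodule generated by the elements $x$ for which there is a maximal ideal $\mathfrak m$ such that $x\in\mathfrak m^{f(\mathfrak m)}M$ and $\mathfrak m^n x=0$ for some positive integer $n$ (where $\mathfrak m^{\infty}M:=\bigcap_{n}\mathfrak m^nM$). For every left adjoint $L$ of the inclusion of $\mathcal{A}_f$ (and every choice of the adjunction), there is an isomorphism $L(M)\cong M/u_f(M)$ that carries the unit $M\to L(M)$ to the canonical projection $M\to M/u_f(M)$. Moreover, for every finitely generated projective $A$-module $P$, all maximal ideals $\mathfrak m_1,\dots,\mathfrak m_r$ and all integers $\varepsilon_1,\dots,\varepsilon_r\ge 0$ (with $r\ge 0$), there is an isomorphism $$L\Big(P\oplus\bigoplus_{i=1}^r A/\mathfrak m_i^{\varepsilon_i}\Big)\;\cong\; P\oplus\bigoplus_{i=1}^r A/\mathfrak m_i^{\min\{\varepsilon_i,f(\mathfrak m_i)\}}$$ that carries the unit to the canonical projection. -/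

import Mathlib

open CategoryTheory

universe u

section DedekindReflective

variable (A : Type u) [CommRing A]

/-- A full subcategory of the category of finitely generated `A`-modules (given by its class `P`
of objects) that is replete, reflective (the inclusion functor has a left adjoint), and contains
the (finitely generated) free modules. -/
structure IsRepleteReflectiveContainingFree (P : ObjectProperty (FGModuleCat.{u} A)) : Prop where
  replete : P.IsClosedUnderIsomorphisms
  reflective : P.ι.IsRightAdjoint
  free_mem : ∀ M : FGModuleCat.{u} A, Module.Free A M → P M

/-- The replete reflective full subcategories of finitely generated `A`-modules which contain the
free modules, partially ordered by inclusion. -/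
abbrev RepleteReflectiveSubcategory : Type (u + 1) :=
  {P : ObjectProperty (FGModuleCat.{u} A) // IsRepleteReflectiveContainingFree A P}

variable {A}

/-- The cyclic module `A / 𝔪 ^ n`, as a finitely generated `A`-module. -/
abbrev cyclicPrimary (𝔪 : MaximalSpectrum A) (n : ℕ) : FGModuleCat.{u} A :=
  FGModuleCat.of A (A ⧸ 𝔪.asIdeal ^ n)

/-- The submodule `I ^ k • M` for an extended natural number `k`; for `k = ∞` it is
`⋂ n, I ^ n • M`. -/
def idealPowSMulTop (I : Ideal A) (k : ℕ∞) (M : Type u) [AddCommGroup M] [Module A M] :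
    Submodule A M :=
  ⨅ (n : ℕ) (_ : (n : ℕ∞) ≤ k), I ^ n • (⊤ : Submodule A M)

/-- The submodule of `M` generated by the elements `x` such that, for some maximal ideal `𝔪`,
`x` lies in `𝔪 ^ f 𝔪 • M` and is killed by some positive power of `𝔪`. -/
def excessTorsion (f : MaximalSpectrum A → ℕ∞) (M : Type u) [AddCommGroup M] [Module A M] :
    Submodule A M :=
  Submodule.span A {x : M | ∃ 𝔪 : MaximalSpectrum A,
    x ∈ idealPowSMulTop 𝔪.asIdeal (f 𝔪) M ∧
      ∃ n : ℕ, 0 < n ∧ ∀ a ∈ 𝔪.asIdeal ^ n, a • x = 0}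

/-- The exponent `min {ε, f 𝔪}`. -/
noncomputable def truncExponent (f : MaximalSpectrum A → ℕ∞) (𝔪 : MaximalSpectrum A) (ε : ℕ) : ℕ :=
  (min (ε : ℕ∞) (f 𝔪)).toNat

theorem truncExponent_le (f : MaximalSpectrum A → ℕ∞) (𝔪 : MaximalSpectrum A) (ε : ℕ) :
    truncExponent f 𝔪 ε ≤ ε :=
  ENat.toNat_le_of_le_natCast (min_le_left _ _)

/-- The projection `P ⊕ ⨁ i, A / 𝔪 i ^ ε i ⟶ P ⊕ ⨁ i, A / 𝔪 i ^ min {ε i, f (𝔪 i)}`: the identity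
on `P` and the quotient map on each cyclic summand. -/
noncomputable def truncProjection (f : MaximalSpectrum A → ℕ∞)
    (P : Type u) [AddCommGroup P] [Module A P]
    {r : ℕ} (𝔪 : Fin r → MaximalSpectrum A) (ε : Fin r → ℕ) :
    (P × ((i : Fin r) → A ⧸ (𝔪 i).asIdeal ^ ε i)) →ₗ[A]
      (P × ((i : Fin r) → A ⧸ (𝔪 i).asIdeal ^ truncExponent f (𝔪 i) (ε i))) :=
  LinearMap.prodMap LinearMap.id
    (LinearMap.pi fun i =>
      (Ideal.Quotient.factorₐ A
        (Ideal.pow_le_pow_right (truncExponent_le f (𝔪 i) (ε i)))).toLinearMap ∘ₗ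
          LinearMap.proj i)

end DedekindReflective

/-!
Let `A` be a Dedekind domain that is not a field. Every finitely generated `A`-module is a direct
sum `P ⊕ ⨁ i, A / 𝔪 i ^ ε i` with `P` projective (`exists_linearEquiv_projective_prod_pi`), so a
class of modules that contains the free modules and is closed under isomorphisms, retracts and
finite products is determined by the modules `A / 𝔪 ^ n` in it.

A replete reflective subcategory has these closure properties, and is closed under kernels, because
an object lies in it as soon as its unit admits a retraction
(`CategoryTheory.Adjunction.prop_of_unit_comp_eq_id`). As `A / 𝔪 ^ n` is the kernel of an
endomorphism of `A / 𝔪 ^ (n + 1)`, the exponents `n` with `A / 𝔪 ^ n` in the subcategory form an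
initial segment of `ℕ`, recorded by `primaryExponent`. Since `A / 𝔪 ^ n` embeds in
`P ⊕ ⨁ i, A / 𝔪 i ^ ε i` only if `n = 0` or `𝔪 = 𝔪 i` and `n ≤ ε i` for some `i`
(`exists_le_exponent_of_injective`), the subcategory consists of exactly the modules bounded by its
exponent function (`primaryBounded_primaryExponent`).

Conversely, the modules bounded by an arbitrary function `f` form a reflective subcategory. A
bounded module has no excess torsion: in each summand the divisibility by `𝔪 ^ f 𝔪` forces an
`𝔪`-primary element to vanish (`excessTorsion_eq_bot`). Hence every map to a bounded module kills
the excess torsion of its source. On `P ⊕ ⨁ i, A / 𝔪 i ^ ε i` the excess torsion is the kernel of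
the truncation (`ker_truncProjection`), whose target is bounded, so that the quotient by the excess
torsion is bounded in general and is the reflection. Uniqueness of universal arrows
(`CategoryTheory.Adjunction.exists_iso_of_universal`) then describes every left adjoint.
-/

/-! ### Finitely generated modules over a Dedekind domain -/

section Decomposition

variable {A : Type u} [CommRing A]

/-- If `N` is killed by a power of a maximal ideal `𝔪`, then the elements outside `𝔪` already act
invertibly on `N`. -/
theorem isLocalizedModule_id_of_isTorsionBySet_pow {𝔪 : Ideal A} [h𝔪 : 𝔪.IsMaximal]
    {N : Type u} [AddCommGroup N] [Module A N] {e : ℕ}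
    (hN : Module.IsTorsionBySet A N (𝔪 ^ e : Ideal A)) :
    IsLocalizedModule 𝔪.primeCompl (LinearMap.id : N →ₗ[A] N) where
  map_units s := by
    have hcop : IsCoprime (Ideal.span {(s : A)}) (𝔪 ^ e) := by
      refine IsCoprime.pow_right ?_
      rw [Ideal.isCoprime_iff_sup_eq, sup_comm]
      refine h𝔪.out.2 _ (lt_of_le_of_ne le_sup_left fun h => s.2 ?_)
      exact h.ge (Ideal.mem_sup_right (Ideal.mem_span_singleton_self _))
    obtain ⟨i, hi, c, hc, hic⟩ := Ideal.isCoprime_iff_exists.1 hcop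
    obtain ⟨b, rfl⟩ := Ideal.mem_span_singleton'.1 hi
    have hN' : ∀ x : N, c • x = 0 := fun x => @hN x ⟨c, hc⟩
    have key : ∀ x : N, (b * s) • x = x := fun x => by
      have h1 : (b * s + c) • x = x := by rw [hic, one_smul]
      rwa [add_smul, hN' x, add_zero] at h1
    refine (Module.End.isUnit_iff _).2 ⟨fun x y hxy => ?_, fun x => ⟨b • x, ?_⟩⟩
    · have hxy' : (s : A) • x = (s : A) • y := hxy
      rw [← key x, ← key y, mul_smul, mul_smul, hxy']
    · change (s : A) • b • x = x
      rw [smul_smul, mul_comm, key]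
  surj y := ⟨(y, 1), by simp⟩
  exists_of_eq h := ⟨1, by simpa using h⟩

variable [IsDedekindDomain A]

/-- A module killed by a power of `𝔪` is its own localization at `𝔪`, so the structure theorem over
the discrete valuation ring `A_𝔪` applies to it. -/
theorem exists_linearEquiv_pi_of_isTorsionBySet_pow {𝔪 : Ideal A} [h𝔪 : 𝔪.IsMaximal]
    (hbot : 𝔪 ≠ ⊥) {N : Type u} [AddCommGroup N] [Module A N] [Module.Finite A N] {e : ℕ}
    (hN : Module.IsTorsionBySet A N (𝔪 ^ e : Ideal A)) :
    ∃ (d : ℕ) (k : Fin d → ℕ), Nonempty (N ≃ₗ[A] ((i : Fin d) → A ⧸ 𝔪 ^ k i)) := by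
  have hloc := isLocalizedModule_id_of_isTorsionBySet_pow hN
  let R := Localization.AtPrime 𝔪
  have : IsDiscreteValuationRing R :=
    IsLocalization.AtPrime.isDiscreteValuationRing_of_dedekind_domain A hbot R
  obtain ⟨ϖ, hϖ⟩ := IsDiscreteValuationRing.exists_irreducible R
  have hmax : IsLocalRing.maximalIdeal R = Ideal.span {ϖ} := hϖ.maximalIdeal_eq
  let N' := LocalizedModule 𝔪.primeCompl N
  have : Module.Finite R N' := inferInstance
  let φ : N' ≃ₗ[A] N := IsLocalizedModule.iso 𝔪.primeCompl (LinearMap.id : N →ₗ[A] N)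
  have hkill : ∀ x : N', ϖ ^ e • x = 0 := by
    have hmem : ϖ ^ e ∈ (𝔪 ^ e).map (algebraMap A R) := by
      rw [Ideal.map_pow, IsLocalization.AtPrime.map_eq_maximalIdeal 𝔪 R, hmax]
      exact Ideal.pow_mem_pow (Ideal.mem_span_singleton_self _) _
    intro x
    have hle : (𝔪 ^ e).map (algebraMap A R) ≤ Ideal.torsionOf R N' x := by
      refine Ideal.map_le_iff_le_comap.2 fun a ha => ?_
      rw [Ideal.mem_comap, Ideal.mem_torsionOf_iff, algebraMap_smul]
      exact φ.injective (by rw [map_smul, map_zero]; exact @hN (φ x) ⟨a, ha⟩)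
    exact (Ideal.mem_torsionOf_iff _ _).1 (hle hmem)
  obtain ⟨d, k, ⟨ψ⟩⟩ := Module.torsion_by_prime_power_decomposition (M := N') hϖ
    ((Submodule.isTorsion'_powers_iff _).2 fun x => ⟨e, hkill x⟩)
  have hpow : ∀ n : ℕ, IsLocalRing.maximalIdeal R ^ n = Ideal.span {ϖ ^ n} := fun n => by
    rw [hmax, Ideal.span_singleton_pow]
  refine ⟨d, k, ⟨φ.symm ≪≫ₗ (ψ ≪≫ₗ DirectSum.linearEquivFunOnFintype R (Fin d) _).restrictScalars A
    ≪≫ₗ LinearEquiv.piCongrRight fun i => ?_⟩⟩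
  exact (((IsLocalization.AtPrime.equivQuotMaximalIdealPow 𝔪 R (k i)).toLinearEquiv ≪≫ₗ
    (Submodule.quotEquivOfEq _ _ (hpow (k i))).restrictScalars A)).symm

/-- The primary decomposition reduces to modules killed by a power of one maximal ideal. -/
theorem exists_linearEquiv_pi_of_isTorsion {N : Type u} [AddCommGroup N] [Module A N]
    [Module.Finite A N] (hN : Module.IsTorsion A N) :
    ∃ (r : ℕ) (𝔪 : Fin r → MaximalSpectrum A) (ε : Fin r → ℕ),
      Nonempty (N ≃ₗ[A] ((i : Fin r) → A ⧸ (𝔪 i).asIdeal ^ ε i)) := by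
  classical
  obtain ⟨S, _, hS, e, hint⟩ := Submodule.exists_isInternal_prime_power_torsion hN
  have hmax : ∀ p : S, (p : Ideal A).IsMaximal := fun p =>
    (Ideal.isPrime_of_prime (hS p p.2)).isMaximal (hS p p.2).ne_zero
  have hdec : ∀ p : S, ∃ (d : ℕ) (k : Fin d → ℕ),
      Nonempty (Submodule.torsionBySet A N ((p : Ideal A) ^ e p : Ideal A) ≃ₗ[A]
        ((i : Fin d) → A ⧸ (p : Ideal A) ^ k i)) := fun p =>
    haveI := hmax p
    exists_linearEquiv_pi_of_isTorsionBySet_pow (hS p p.2).ne_zero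
      (Submodule.torsionBySet_isTorsionBySet _)
  choose d k φ using hdec
  let σ : (Σ p : S, Fin (d p)) ≃ Fin _ := Fintype.equivFin _
  let 𝔪 : (Σ p : S, Fin (d p)) → MaximalSpectrum A := fun x => ⟨x.1, hmax x.1⟩
  let ψ : N ≃ₗ[A] ((x : Σ p : S, Fin (d p)) → A ⧸ (𝔪 x).asIdeal ^ k x.1 x.2) :=
    (LinearEquiv.ofBijective (DirectSum.coeLinearMap _) hint).symm ≪≫ₗ
      DirectSum.linearEquivFunOnFintype A S _ ≪≫ₗ
      LinearEquiv.piCongrRight (fun p => (φ p).some) ≪≫ₗ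
      (LinearEquiv.piCurry A fun (p : S) (i : Fin (d p)) => A ⧸ (p : Ideal A) ^ k p i).symm
  exact ⟨_, fun j => 𝔪 (σ.symm j), fun j => k (σ.symm j).1 (σ.symm j).2,
    ⟨ψ ≪≫ₗ LinearEquiv.piCongrLeft' A _ σ⟩⟩

/-- The structure theorem: a finitely generated module over a Dedekind domain is the direct sum of
a projective module and of cyclic modules `A / 𝔪 ^ ε`. -/
theorem exists_linearEquiv_projective_prod_pi (M : Type u) [AddCommGroup M] [Module A M]
    [Module.Finite A M] :
    ∃ (P : Type u) (_ : AddCommGroup P) (_ : Module A P) (_ : Module.Finite A P)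
      (_ : Module.Projective A P) (r : ℕ) (𝔪 : Fin r → MaximalSpectrum A) (ε : Fin r → ℕ),
      Nonempty (M ≃ₗ[A] P × ((i : Fin r) → A ⧸ (𝔪 i).asIdeal ^ ε i)) := by
  let T := Submodule.torsion A M
  have : Module.Flat A (M ⧸ T) :=
    IsDedekindDomain.flat_iff_torsion_eq_bot.2 Submodule.QuotientTorsion.torsion_eq_bot
  have : Module.FinitePresentation A (M ⧸ T) := Module.finitePresentation_of_finite A _
  have hproj : Module.Projective A (M ⧸ T) := Module.Flat.projective_of_finitePresentation
  obtain ⟨s, hs⟩ := Module.projective_lifting_property T.mkQ LinearMap.id T.mkQ_surjective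
  obtain ⟨r, 𝔪, ε, ⟨φ⟩⟩ := exists_linearEquiv_pi_of_isTorsion
    (Submodule.torsion_isTorsion (R := A) (M := M))
  have ψ : (T × (M ⧸ T)) ≃ₗ[A] M :=
    lequivProdOfRightSplitExact T.subtype_injective (by simp) hs
  exact ⟨M ⧸ T, inferInstance, inferInstance, inferInstance, hproj, r, 𝔪, ε,
    ⟨ψ.symm ≪≫ₗ LinearEquiv.prodComm A _ _ ≪≫ₗ LinearEquiv.prodCongr (.refl A _) φ⟩⟩

end Decomposition

/-! ### Bounded modules and excess torsion -/

section ExcessTorsion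

variable {A : Type u} [CommRing A]

/-- The modules that contain a copy of `A / 𝔪 ^ n` only if `n ≤ f 𝔪`. -/
def IsPrimaryBounded (f : MaximalSpectrum A → ℕ∞) (M : Type u) [AddCommGroup M] [Module A M] :
    Prop :=
  ∀ (𝔪 : MaximalSpectrum A) (n : ℕ),
    (∃ g : (A ⧸ 𝔪.asIdeal ^ n) →ₗ[A] M, Function.Injective g) → (n : ℕ∞) ≤ f 𝔪

variable {f : MaximalSpectrum A → ℕ∞} {M N : Type u} [AddCommGroup M] [Module A M]
  [AddCommGroup N] [Module A N]

theorem IsPrimaryBounded.of_injective (hN : IsPrimaryBounded f N) (g : M →ₗ[A] N)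
    (hg : Function.Injective g) : IsPrimaryBounded f M :=
  fun 𝔪 n ⟨h, hh⟩ => hN 𝔪 n ⟨g ∘ₗ h, hg.comp hh⟩

theorem pow_smul_quotient_pow (I : Ideal A) (n : ℕ) :
    I ^ n • (⊤ : Submodule A (A ⧸ I ^ n)) = ⊥ := by
  rw [eq_bot_iff, Submodule.smul_le]
  intro a ha x _
  obtain ⟨b, rfl⟩ := Ideal.Quotient.mk_surjective x
  rw [Submodule.mem_bot, ← Ideal.Quotient.mk_eq_mk, ← Submodule.Quotient.mk_smul,
    Submodule.Quotient.mk_eq_zero]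
  exact Ideal.mul_mem_right _ _ ha

theorem pow_smul_eq_zero {I : Ideal A} {n : ℕ} {a : A} (ha : a ∈ I ^ n) (x : A ⧸ I ^ n) :
    a • x = 0 := by
  rw [← Submodule.mem_bot A, ← pow_smul_quotient_pow I n]
  exact Submodule.smul_mem_smul ha trivial

theorem map_mem_ideal_smul_top (I : Ideal A) (g : M →ₗ[A] N) {x : M}
    (hx : x ∈ I • (⊤ : Submodule A M)) : g x ∈ I • (⊤ : Submodule A N) := by
  have h := Submodule.mem_map_of_mem (f := g) hx
  rw [Submodule.map_smul''] at h
  exact Submodule.smul_mono le_rfl le_top h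

theorem mem_idealPowSMulTop {I : Ideal A} {k : ℕ∞} {x : M} :
    x ∈ idealPowSMulTop I k M ↔ ∀ n : ℕ, (n : ℕ∞) ≤ k → x ∈ I ^ n • (⊤ : Submodule A M) := by
  simp [idealPowSMulTop, Submodule.mem_iInf]

theorem excessTorsion_le_comap (f : MaximalSpectrum A → ℕ∞) (g : M →ₗ[A] N) :
    excessTorsion f M ≤ (excessTorsion f N).comap g := by
  refine Submodule.span_le.2 ?_
  rintro x ⟨𝔪, hx, n, hn, hk⟩
  refine Submodule.subset_span ⟨𝔪, ?_, n, hn, fun a ha => ?_⟩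
  · exact mem_idealPowSMulTop.2 fun j hj =>
      map_mem_ideal_smul_top _ g (mem_idealPowSMulTop.1 hx j hj)
  · rw [← map_smul, hk a ha, map_zero]

theorem excessTorsion_map_linearEquiv (f : MaximalSpectrum A → ℕ∞) (φ : M ≃ₗ[A] N) :
    (excessTorsion f M).map (φ : M →ₗ[A] N) = excessTorsion f N := by
  refine le_antisymm (Submodule.map_le_iff_le_comap.2 (excessTorsion_le_comap f _)) fun x hx => ?_
  exact ⟨φ.symm x, excessTorsion_le_comap f (φ.symm : N →ₗ[A] M) hx, by simp⟩

/-- An element killed by powers of two distinct maximal ideals vanishes, as these powers are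
comaximal. -/
theorem eq_zero_of_pow_smul_eq_zero {𝔪 𝔪' : MaximalSpectrum A} (hne : 𝔪 ≠ 𝔪') {m n : ℕ} {x : M}
    (hx : ∀ a ∈ 𝔪.asIdeal ^ m, a • x = 0) (hx' : ∀ a ∈ 𝔪'.asIdeal ^ n, a • x = 0) : x = 0 := by
  have hcop : IsCoprime (𝔪.asIdeal ^ m) (𝔪'.asIdeal ^ n) := by
    refine IsCoprime.pow ?_
    rw [Ideal.isCoprime_iff_sup_eq]
    exact 𝔪.isMaximal.coprime_of_ne 𝔪'.isMaximal fun h => hne (MaximalSpectrum.ext h)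
  obtain ⟨i, hi, j, hj, hij⟩ := Ideal.isCoprime_iff_exists.1 hcop
  rw [← one_smul A x, ← hij, add_smul, hx i hi, hx' j hj, add_zero]

section Decomposed

variable (P : Type u) [AddCommGroup P] [Module A P]
  {r : ℕ} (𝔪 : Fin r → MaximalSpectrum A) (ε : Fin r → ℕ)

/-- The inclusion of the `i`-th cyclic summand into `P ⊕ ⨁ j, A / 𝔪 j ^ ε j`. -/
def cyclicInclusion (i : Fin r) :
    (A ⧸ (𝔪 i).asIdeal ^ ε i) →ₗ[A] P × ((j : Fin r) → A ⧸ (𝔪 j).asIdeal ^ ε j) :=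
  LinearMap.inr A P _ ∘ₗ LinearMap.single A (fun j => A ⧸ (𝔪 j).asIdeal ^ ε j) i

theorem cyclicInclusion_injective (i : Fin r) : Function.Injective (cyclicInclusion P 𝔪 ε i) :=
  fun _ _ h => Pi.single_injective i (congrArg Prod.snd h)

variable {P 𝔪 ε} in
theorem IsPrimaryBounded.exponent_le
    (h : IsPrimaryBounded f (P × ((i : Fin r) → A ⧸ (𝔪 i).asIdeal ^ ε i))) (i : Fin r) :
    (ε i : ℕ∞) ≤ f (𝔪 i) :=
  h _ _ ⟨_, cyclicInclusion_injective P 𝔪 ε i⟩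

theorem truncExponent_coe (f : MaximalSpectrum A → ℕ∞) (𝔪 : MaximalSpectrum A) (ε : ℕ) :
    (truncExponent f 𝔪 ε : ℕ∞) = min (ε : ℕ∞) (f 𝔪) :=
  ENat.natCast_toNat (ne_top_of_le_ne_top (ENat.natCast_ne_top ε) (min_le_left _ _))

theorem truncProjection_surjective (f : MaximalSpectrum A → ℕ∞) :
    Function.Surjective (truncProjection f P 𝔪 ε) := by
  rintro ⟨p, y⟩
  choose x hx using fun i => Ideal.Quotient.factor_surjective
    (Ideal.pow_le_pow_right (I := (𝔪 i).asIdeal) (truncExponent_le f (𝔪 i) (ε i))) (y i)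
  exact ⟨(p, x), Prod.ext rfl (funext hx)⟩

/-- An element of the kernel is the sum of its cyclic components, each of which is a generator of the
excess torsion. -/
theorem ker_truncProjection_le (f : MaximalSpectrum A → ℕ∞) :
    LinearMap.ker (truncProjection f P 𝔪 ε) ≤ excessTorsion f _ := by
  rintro ⟨p, x⟩ hx
  have hp : p = 0 := congrArg Prod.fst hx
  have hx' : ∀ i, Ideal.Quotient.factor
      (Ideal.pow_le_pow_right (I := (𝔪 i).asIdeal) (truncExponent_le f (𝔪 i) (ε i))) (x i) = 0 :=
    fun i => congrFun (congrArg Prod.snd hx) i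
  have hsum : (p, x) = ∑ i, cyclicInclusion P 𝔪 ε i (x i) := by
    simp only [cyclicInclusion, LinearMap.comp_apply, LinearMap.coe_single]
    rw [← map_sum, Finset.univ_sum_single, hp, LinearMap.inr_apply]
  rw [hsum]
  refine Submodule.sum_mem _ fun i _ => excessTorsion_le_comap f (cyclicInclusion P 𝔪 ε i) ?_
  refine Submodule.subset_span ⟨𝔪 i, mem_idealPowSMulTop.2 fun n hn => ?_, ε i + 1, by omega,
    fun a ha => pow_smul_eq_zero (Ideal.pow_le_pow_right (Nat.le_succ _) ha) _⟩
  obtain ⟨a, ha⟩ := Ideal.Quotient.mk_surjective (x i)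
  have hmem : a ∈ (𝔪 i).asIdeal ^ truncExponent f (𝔪 i) (ε i) := by
    have h := hx' i
    rwa [← ha, Ideal.Quotient.factor_mk, Ideal.Quotient.eq_zero_iff_mem] at h
  have htrunc := truncExponent_coe f (𝔪 i) (ε i)
  rcases le_total (ε i : ℕ∞) (f (𝔪 i)) with h | h
  · rw [min_eq_left h, Nat.cast_inj] at htrunc
    rw [htrunc, ← Ideal.Quotient.eq_zero_iff_mem, ha] at hmem
    rw [hmem]
    exact zero_mem _
  · rw [min_eq_right h] at htrunc
    rw [← htrunc, Nat.cast_le] at hn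
    have hsmul : x i = a • (1 : A ⧸ (𝔪 i).asIdeal ^ ε i) := by
      rw [← ha, Algebra.smul_def, mul_one]; rfl
    rw [hsmul]
    exact Submodule.smul_mem_smul (Ideal.pow_le_pow_right hn hmem) trivial

end Decomposed

section Dedekind

variable [IsDedekindDomain A]

theorem exists_mem_pow_notMem_pow_succ (hA : ¬ IsField A) (𝔪 : MaximalSpectrum A) (n : ℕ) :
    ∃ a ∈ 𝔪.asIdeal ^ n, a ∉ 𝔪.asIdeal ^ (n + 1) :=
  Ideal.exists_mem_pow_notMem_pow_succ _
    (Ring.ne_bot_of_isMaximal_of_not_isField 𝔪.isMaximal hA) 𝔪.isMaximal.ne_top n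

theorem Module.Projective.eq_zero_of_pow_smul_eq_zero (hA : ¬ IsField A) {P : Type u}
    [AddCommGroup P] [Module A P] [Module.Projective A P] {𝔪 : MaximalSpectrum A} {n : ℕ} {x : P}
    (hx : ∀ a ∈ 𝔪.asIdeal ^ n, a • x = 0) : x = 0 := by
  obtain ⟨a, ha, ha'⟩ := exists_mem_pow_notMem_pow_succ hA 𝔪 n
  have ha0 : a ≠ 0 := fun h => ha' (h ▸ zero_mem _)
  have htors : Submodule.torsion A P = ⊥ := IsDedekindDomain.flat_iff_torsion_eq_bot.1 inferInstance
  rw [← Submodule.mem_bot A, ← htors]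
  exact ⟨⟨a, mem_nonZeroDivisors_of_ne_zero ha0⟩, hx a ha⟩

/-- The cyclic module `A / 𝔪 ^ n` embeds in a direct sum only if it embeds in a summand: an element
of `𝔪 ^ (n - 1)` outside `𝔪 ^ n` acts nontrivially on the image of `1`, hence on one of its
components. -/
theorem exists_le_exponent_of_injective (hA : ¬ IsField A) {P : Type u} [AddCommGroup P]
    [Module A P] [Module.Projective A P] {r : ℕ} {𝔪 : Fin r → MaximalSpectrum A} {ε : Fin r → ℕ}
    {𝔫 : MaximalSpectrum A} {n : ℕ} (hn : n ≠ 0)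
    (g : (A ⧸ 𝔫.asIdeal ^ n) →ₗ[A] P × ((i : Fin r) → A ⧸ (𝔪 i).asIdeal ^ ε i))
    (hg : Function.Injective g) : ∃ i, 𝔪 i = 𝔫 ∧ n ≤ ε i := by
  by_contra! hcon
  obtain ⟨n, rfl⟩ := Nat.exists_eq_succ_of_ne_zero hn
  obtain ⟨a, ha, ha'⟩ := exists_mem_pow_notMem_pow_succ hA 𝔫 n
  refine ha' (Ideal.Quotient.eq_zero_iff_mem.1 (hg ?_))
  rw [map_zero]
  have hker : ∀ b ∈ 𝔫.asIdeal ^ (n + 1), b • g (Ideal.Quotient.mk _ a) = 0 := fun b hb => by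
    rw [← map_smul, pow_smul_eq_zero hb, map_zero]
  have hsmul : g (Ideal.Quotient.mk _ a) = a • g 1 := by
    rw [← map_smul, Algebra.smul_def, mul_one]; rfl
  refine Prod.ext ?_ (funext fun i => ?_)
  · exact Module.Projective.eq_zero_of_pow_smul_eq_zero hA fun b hb => congrArg Prod.fst (hker b hb)
  · by_cases hi : 𝔪 i = 𝔫
    · have hlt := hcon i hi
      rw [hsmul]
      refine pow_smul_eq_zero (Ideal.pow_le_pow_right (show ε i ≤ n by omega) ?_) _
      rwa [hi]
    · exact eq_zero_of_pow_smul_eq_zero (M := A ⧸ (𝔪 i).asIdeal ^ ε i) hi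
        (fun b hb => pow_smul_eq_zero hb _) (fun b hb => congrFun (congrArg Prod.snd (hker b hb)) i)

theorem isPrimaryBounded_prod_pi (hA : ¬ IsField A) (P : Type u) [AddCommGroup P]
    [Module A P] [Module.Projective A P] {r : ℕ} {𝔪 : Fin r → MaximalSpectrum A} {ε : Fin r → ℕ}
    (h : ∀ i, (ε i : ℕ∞) ≤ f (𝔪 i)) :
    IsPrimaryBounded f (P × ((i : Fin r) → A ⧸ (𝔪 i).asIdeal ^ ε i)) := by
  rintro 𝔫 n ⟨g, hg⟩
  rcases eq_or_ne n 0 with rfl | hn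
  · simp
  · obtain ⟨i, rfl, hi⟩ := exists_le_exponent_of_injective hA hn g hg
    exact (Nat.cast_le.2 hi).trans (h i)

theorem isPrimaryBounded_quotient_pow_iff (hA : ¬ IsField A) {𝔪 : MaximalSpectrum A} {n : ℕ} :
    IsPrimaryBounded f (A ⧸ 𝔪.asIdeal ^ n) ↔ (n : ℕ∞) ≤ f 𝔪 := by
  refine ⟨fun h => h 𝔪 n ⟨LinearMap.id, Function.injective_id⟩, fun h => ?_⟩
  have hbd : IsPrimaryBounded f (PUnit.{u + 1} × ((_ : Fin 1) → A ⧸ 𝔪.asIdeal ^ n)) :=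
    isPrimaryBounded_prod_pi hA PUnit.{u + 1} fun _ => h
  exact hbd.of_injective (cyclicInclusion PUnit.{u + 1} (fun _ : Fin 1 => 𝔪) (fun _ => n) 0)
    (cyclicInclusion_injective _ _ _ 0)

/-- In a decomposition of `N` the exponents are bounded by `f`. An element of `𝔪 ^ f 𝔪 N` killed by a
power of `𝔪` has trivial components: in the projective part because that part is torsion-free, in
`A / 𝔪' ^ ε` with `𝔪' ≠ 𝔪` by comaximality, and in `A / 𝔪 ^ ε` because `ε ≤ f 𝔪`. -/
theorem excessTorsion_eq_bot (hA : ¬ IsField A) [Module.Finite A N] (hN : IsPrimaryBounded f N) :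
    excessTorsion f N = ⊥ := by
  obtain ⟨P, _, _, _, _, r, 𝔪, ε, ⟨φ⟩⟩ := exists_linearEquiv_projective_prod_pi (A := A) N
  have hbd := (hN.of_injective _ φ.symm.injective).exponent_le
  refine eq_bot_iff.2 (Submodule.span_le.2 ?_)
  rintro x ⟨𝔫, hx, n, -, hk⟩
  have hker : ∀ b ∈ 𝔫.asIdeal ^ n, b • φ x = 0 := fun b hb => by
    rw [← map_smul, hk b hb, map_zero]
  refine φ.injective ((map_zero φ).symm ▸ Prod.ext ?_ (funext fun i => ?_))
  · exact Module.Projective.eq_zero_of_pow_smul_eq_zero hA fun b hb => congrArg Prod.fst (hker b hb)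
  · by_cases hi : 𝔪 i = 𝔫
    · subst hi
      refine (Submodule.mem_bot A).1 ?_
      rw [← pow_smul_quotient_pow]
      exact map_mem_ideal_smul_top _
        (LinearMap.proj i ∘ₗ LinearMap.snd A P ((j : Fin r) → A ⧸ (𝔪 j).asIdeal ^ ε j) ∘ₗ
          φ.toLinearMap)
        (mem_idealPowSMulTop.1 hx _ (hbd i))
    · exact eq_zero_of_pow_smul_eq_zero (M := A ⧸ (𝔪 i).asIdeal ^ ε i) hi
        (fun b hb => pow_smul_eq_zero hb _) (fun b hb => congrFun (congrArg Prod.snd (hker b hb)) i)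

theorem excessTorsion_le_ker (hA : ¬ IsField A) [Module.Finite A N] (hN : IsPrimaryBounded f N)
    (g : M →ₗ[A] N) : excessTorsion f M ≤ LinearMap.ker g := by
  have h := excessTorsion_le_comap f g
  rwa [excessTorsion_eq_bot hA hN] at h

section

variable (f : MaximalSpectrum A → ℕ∞) (P : Type u) [AddCommGroup P] [Module A P] [Module.Projective A P]
  {r : ℕ} (𝔪 : Fin r → MaximalSpectrum A) (ε : Fin r → ℕ)

theorem isPrimaryBounded_truncProjection_target (hA : ¬ IsField A) :
    IsPrimaryBounded f (P × ((i : Fin r) → A ⧸ (𝔪 i).asIdeal ^ truncExponent f (𝔪 i) (ε i))) :=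
  isPrimaryBounded_prod_pi hA P fun i => by
    rw [truncExponent_coe]; exact min_le_right _ _

theorem ker_truncProjection (hA : ¬ IsField A) [Module.Finite A P] :
    LinearMap.ker (truncProjection f P 𝔪 ε) = excessTorsion f _ :=
  le_antisymm (ker_truncProjection_le P 𝔪 ε f)
    (excessTorsion_le_ker hA (isPrimaryBounded_truncProjection_target f P 𝔪 ε hA) _)

end

/-- After decomposing `M`, the quotient is the target of the truncation. -/
theorem isPrimaryBounded_quotient_excessTorsion (hA : ¬ IsField A) (f : MaximalSpectrum A → ℕ∞)
    (M : Type u) [AddCommGroup M] [Module A M] [Module.Finite A M] :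
    IsPrimaryBounded f (M ⧸ excessTorsion f M) := by
  obtain ⟨P, _, _, _, _, r, 𝔪, ε, ⟨φ⟩⟩ := exists_linearEquiv_projective_prod_pi (A := A) M
  let ψ := Submodule.Quotient.equiv _ _ φ (excessTorsion_map_linearEquiv f φ) ≪≫ₗ
    Submodule.quotEquivOfEq _ _ (ker_truncProjection f P 𝔪 ε hA).symm ≪≫ₗ
    (truncProjection f P 𝔪 ε).quotKerEquivOfSurjective (truncProjection_surjective P 𝔪 ε f)
  exact (isPrimaryBounded_truncProjection_target f P 𝔪 ε hA).of_injective ψ.toLinearMap ψ.injective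

end Dedekind

end ExcessTorsion

/-! ### Closure properties of reflective subcategories -/

section Reflector

universe v w

variable {C : Type w} [Category.{v} C] {P : ObjectProperty C} {L : C ⥤ P.FullSubcategory}
  (adj : L ⊣ P.ι)

theorem CategoryTheory.Adjunction.exists_unit_comp_eq {X N : C} (hN : P N) (g : X ⟶ N) :
    ∃ h : (L.obj X).obj ⟶ N, adj.unit.app X ≫ h = g :=
  ⟨((adj.homEquiv X ⟨N, hN⟩).symm g).hom,
    (adj.homEquiv_unit (f := (adj.homEquiv X ⟨N, hN⟩).symm g)).symm.trans
      (Equiv.apply_symm_apply _ _)⟩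

theorem CategoryTheory.Adjunction.unit_comp_injective {X N : C} (hN : P N)
    {h h' : (L.obj X).obj ⟶ N} (e : adj.unit.app X ≫ h = adj.unit.app X ≫ h') : h = h' := by
  have key : (ObjectProperty.homMk h : L.obj X ⟶ ⟨N, hN⟩) = ObjectProperty.homMk h' := by
    apply (adj.homEquiv X ⟨N, hN⟩).injective
    rw [adj.homEquiv_unit, adj.homEquiv_unit]
    exact e
  exact congrArg InducedCategory.Hom.hom key

/-- Any two universal arrows from `X` to the subcategory are isomorphic under `X`. -/
theorem CategoryTheory.Adjunction.exists_iso_of_universal {X Q : C} (hQ : P Q) (q : X ⟶ Q) [Epi q]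
    (hq : ∀ N, P N → ∀ g : X ⟶ N, ∃ h : Q ⟶ N, q ≫ h = g) :
    ∃ i : (L.obj X).obj ≅ Q, adj.unit.app X ≫ i.hom = q := by
  obtain ⟨a, ha⟩ := adj.exists_unit_comp_eq hQ q
  obtain ⟨b, hb⟩ := hq _ (L.obj X).property (adj.unit.app X)
  refine ⟨⟨a, b, adj.unit_comp_injective (L.obj X).property ?_, ?_⟩, ha⟩
  · rw [reassoc_of% ha, hb]
    exact (Category.comp_id _).symm
  · rw [← cancel_epi q, reassoc_of% hb, ha, Category.comp_id]

variable [P.IsClosedUnderIsomorphisms]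

/-- An object onto which its reflection retracts, compatibly with the unit, lies in the
subcategory. -/
theorem CategoryTheory.Adjunction.prop_of_unit_comp_eq_id {X : C} (r : (L.obj X).obj ⟶ X)
    (hr : adj.unit.app X ≫ r = 𝟙 X) : P X :=
  P.prop_of_iso ⟨r, adj.unit.app X, adj.unit_comp_injective (L.obj X).property (by
    rw [reassoc_of% hr]
    exact (Category.comp_id _).symm), hr⟩ (L.obj X).property

end Reflector

namespace IsRepleteReflectiveContainingFree

variable {A : Type u} [CommRing A] {P : ObjectProperty (FGModuleCat.{u} A)}

theorem exists_adjunction (hP : IsRepleteReflectiveContainingFree A P) :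
    ∃ L : FGModuleCat.{u} A ⥤ P.FullSubcategory, Nonempty (L ⊣ P.ι) :=
  have := hP.reflective
  ⟨P.ι.leftAdjoint, ⟨Adjunction.ofIsRightAdjoint P.ι⟩⟩

section Closure

variable {M N N' : Type u} [AddCommGroup M] [Module A M] [Module.Finite A M]
  [AddCommGroup N] [Module A N] [Module.Finite A N]
  [AddCommGroup N'] [Module A N'] [Module.Finite A N']

theorem of_linearEquiv (hP : IsRepleteReflectiveContainingFree A P) (φ : N ≃ₗ[A] M)
    (hN : P (FGModuleCat.of A N)) : P (FGModuleCat.of A M) :=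
  have := hP.replete
  P.prop_of_iso φ.toFGModuleCatIso hN

theorem of_retract (hP : IsRepleteReflectiveContainingFree A P) (i : M →ₗ[A] N) (p : N →ₗ[A] M)
    (h : p ∘ₗ i = LinearMap.id) (hN : P (FGModuleCat.of A N)) : P (FGModuleCat.of A M) := by
  obtain ⟨L, ⟨adj⟩⟩ := hP.exists_adjunction
  have := hP.replete
  obtain ⟨k, hk⟩ := adj.exists_unit_comp_eq hN (FGModuleCat.ofHom i)
  refine adj.prop_of_unit_comp_eq_id (k ≫ FGModuleCat.ofHom p) ?_
  rw [reassoc_of% hk]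
  exact FGModuleCat.hom_ext h

theorem of_pi (hP : IsRepleteReflectiveContainingFree A P) {ι : Type} [Finite ι] {X : ι → Type u}
    [∀ j, AddCommGroup (X j)] [∀ j, Module A (X j)] [∀ j, Module.Finite A (X j)]
    (hX : ∀ j, P (FGModuleCat.of A (X j))) : P (FGModuleCat.of A ((j : ι) → X j)) := by
  obtain ⟨L, ⟨adj⟩⟩ := hP.exists_adjunction
  have := hP.replete
  choose k hk using fun j => adj.exists_unit_comp_eq (hX j)
    (FGModuleCat.ofHom (LinearMap.proj j : ((j : ι) → X j) →ₗ[A] X j))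
  refine adj.prop_of_unit_comp_eq_id (FGModuleCat.ofHom (LinearMap.pi fun j => (k j).hom.hom)) ?_
  refine FGModuleCat.hom_ext (LinearMap.ext fun x => funext fun j => ?_)
  exact congrArg (fun g => g.hom.hom x) (hk j)

theorem of_prod (hP : IsRepleteReflectiveContainingFree A P) (hM : P (FGModuleCat.of A M))
    (hN : P (FGModuleCat.of A N)) : P (FGModuleCat.of A (M × N)) := by
  obtain ⟨L, ⟨adj⟩⟩ := hP.exists_adjunction
  have := hP.replete
  obtain ⟨k, hk⟩ := adj.exists_unit_comp_eq hM (FGModuleCat.ofHom (LinearMap.fst A M N))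
  obtain ⟨l, hl⟩ := adj.exists_unit_comp_eq hN (FGModuleCat.ofHom (LinearMap.snd A M N))
  refine adj.prop_of_unit_comp_eq_id (FGModuleCat.ofHom (k.hom.hom.prod l.hom.hom)) ?_
  refine FGModuleCat.hom_ext (LinearMap.ext fun x => Prod.ext ?_ ?_)
  · exact congrArg (fun g => g.hom.hom x) hk
  · exact congrArg (fun g => g.hom.hom x) hl

/-- The extension of `i` along the unit is killed by `h`, since `h ∘ i = 0` and extensions are unique;
hence it lands in `M` and retracts the unit. -/
theorem of_kernel (hP : IsRepleteReflectiveContainingFree A P) (i : M →ₗ[A] N) (h : N →ₗ[A] N')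
    (hi : Function.Injective i) (hih : LinearMap.range i = LinearMap.ker h)
    (hN : P (FGModuleCat.of A N)) (hN' : P (FGModuleCat.of A N')) : P (FGModuleCat.of A M) := by
  obtain ⟨L, ⟨adj⟩⟩ := hP.exists_adjunction
  have := hP.replete
  obtain ⟨k, hk⟩ := adj.exists_unit_comp_eq hN (FGModuleCat.ofHom i)
  have hk' : ∀ x, k.hom.hom ((adj.unit.app (FGModuleCat.of A M)).hom.hom x) = i x := fun x =>
    congrArg (fun g => g.hom.hom x) hk
  have hzero : k ≫ FGModuleCat.ofHom h = FGModuleCat.ofHom 0 := by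
    refine adj.unit_comp_injective hN' (FGModuleCat.hom_ext (LinearMap.ext fun x => ?_))
    refine (congrArg h (hk' x)).trans (LinearMap.mem_ker.1 ?_)
    exact hih ▸ LinearMap.mem_range_self i x
  have hrange : ∀ y, k.hom.hom y ∈ LinearMap.range i := fun y => by
    rw [hih]
    exact congrArg (fun g => g.hom.hom y) hzero
  let e := LinearEquiv.ofInjective i hi
  refine adj.prop_of_unit_comp_eq_id
    (FGModuleCat.ofHom (e.symm.toLinearMap ∘ₗ k.hom.hom.codRestrict _ hrange)) ?_
  refine FGModuleCat.hom_ext (LinearMap.ext fun x => e.injective (Subtype.ext ?_))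
  exact (congrArg Subtype.val (e.apply_symm_apply _)).trans (hk' x)

theorem of_projective (hP : IsRepleteReflectiveContainingFree A P) [Module.Projective A M] :
    P (FGModuleCat.of A M) := by
  obtain ⟨n, p, i, -, -, h⟩ := Module.Finite.exists_comp_eq_id_of_projective A M
  exact hP.of_retract i p h (hP.free_mem _ (inferInstanceAs (Module.Free A (Fin n → A))))

end Closure

variable [IsDedekindDomain A]

/-- If `π` generates `𝔪` modulo `𝔪 ^ 2` and `ρ` generates `𝔪 ^ n` modulo `𝔪 ^ (n + 1)`, then
multiplication by `π` identifies `A / 𝔪 ^ n` with the kernel of multiplication by `ρ` on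
`A / 𝔪 ^ (n + 1)`. -/
theorem cyclicPrimary_of_succ (hP : IsRepleteReflectiveContainingFree A P) (hA : ¬ IsField A)
    {𝔪 : MaximalSpectrum A} {n : ℕ} (h : P (cyclicPrimary 𝔪 (n + 1))) :
    P (cyclicPrimary 𝔪 n) := by
  have hbot := Ring.ne_bot_of_isMaximal_of_not_isField 𝔪.isMaximal hA
  have hprime : Prime 𝔪.asIdeal := Ideal.prime_of_isPrime hbot 𝔪.isMaximal.isPrime
  have := 𝔪.isMaximal.isPrime
  obtain ⟨π, hπ, hπ'⟩ := exists_mem_pow_notMem_pow_succ hA 𝔪 1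
  obtain ⟨ρ, hρ, hρ'⟩ := exists_mem_pow_notMem_pow_succ hA 𝔪 n
  rw [pow_one] at hπ
  obtain ⟨J, hJ⟩ := Ideal.dvd_span_singleton.2 hπ
  have hJm : ¬ 𝔪.asIdeal ∣ J := fun hd => hπ' <| by
    rw [← Ideal.dvd_span_singleton, hJ, one_add_one_eq_two, sq]
    exact mul_dvd_mul_left _ hd
  -- the cofactor `J` of `𝔪` in `(π)` is prime to `𝔪`, which gives `(π) + 𝔪 ^ (n + 1) = 𝔪`
  have hsup : Ideal.span {π} ⊔ 𝔪.asIdeal ^ (n + 1) = 𝔪.asIdeal := by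
    have hcop : IsCoprime J (𝔪.asIdeal ^ n) := by
      refine IsCoprime.pow_right ?_
      rw [Ideal.isCoprime_iff_sup_eq, sup_comm]
      exact 𝔪.isMaximal.out.2 _
        (lt_of_le_of_ne le_sup_left fun h => hJm (Ideal.dvd_iff_le.2 (h ▸ le_sup_right)))
    rw [hJ, pow_succ', ← Ideal.mul_sup, Ideal.isCoprime_iff_sup_eq.1 hcop, Ideal.mul_top]
  have hπn : 𝔪.asIdeal ^ n ≤ Submodule.comap (LinearMap.mulLeft A π) (𝔪.asIdeal ^ (n + 1)) := fun a ha => by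
    rw [Submodule.mem_comap, LinearMap.mulLeft_apply, pow_succ']
    exact Ideal.mul_mem_mul hπ ha
  refine hP.of_kernel (Submodule.mapQ _ _ (LinearMap.mulLeft A π) hπn)
    (LinearMap.lsmul A (A ⧸ 𝔪.asIdeal ^ (n + 1)) ρ) ?_ ?_ h h
  · refine (injective_iff_map_eq_zero _).2 fun x hx => ?_
    obtain ⟨a, rfl⟩ := Submodule.mkQ_surjective _ x
    have hmem : π * a ∈ 𝔪.asIdeal ^ (n + 1) := (Submodule.Quotient.mk_eq_zero _).1 hx
    refine (Submodule.Quotient.mk_eq_zero _).2 ?_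
    rw [← Ideal.dvd_span_singleton] at hmem ⊢
    rw [← Ideal.span_singleton_mul_span_singleton, hJ, pow_succ', mul_assoc] at hmem
    exact hprime.pow_dvd_of_dvd_mul_left n hJm ((mul_dvd_mul_iff_left hprime.ne_zero).1 hmem)
  · ext x
    obtain ⟨a, rfl⟩ := Submodule.mkQ_surjective _ x
    have hker : (Submodule.mkQ _ a ∈ LinearMap.ker (LinearMap.lsmul A (A ⧸ 𝔪.asIdeal ^ (n + 1)) ρ))
        ↔ ρ * a ∈ 𝔪.asIdeal ^ (n + 1) := Submodule.Quotient.mk_eq_zero _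
    rw [hker]
    constructor
    · rintro ⟨y, hy⟩
      obtain ⟨b, rfl⟩ := Submodule.mkQ_surjective _ y
      have hb : π * b - a ∈ 𝔪.asIdeal ^ (n + 1) := (Submodule.Quotient.eq _).1 hy
      have ha : a ∈ 𝔪.asIdeal := by
        rw [← sub_sub_cancel (π * b) a]
        exact sub_mem (Ideal.mul_mem_right _ _ hπ) (Ideal.pow_le_self n.succ_ne_zero hb)
      rw [pow_succ]
      exact Ideal.mul_mem_mul hρ ha
    · intro ha
      rw [mul_comm] at ha
      have ha' : a ∈ 𝔪.asIdeal := (Ideal.IsPrime.mul_mem_pow _ ha).resolve_right hρ'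
      rw [← hsup] at ha'
      obtain ⟨b, hb, c, hc, rfl⟩ := Submodule.mem_sup.1 ha'
      obtain ⟨d, rfl⟩ := Ideal.mem_span_singleton'.1 hb
      refine ⟨Submodule.mkQ _ d, (Submodule.Quotient.eq _).2 ?_⟩
      rw [LinearMap.mulLeft_apply, mul_comm, sub_add_cancel_left]
      exact neg_mem hc

theorem cyclicPrimary_of_le (hP : IsRepleteReflectiveContainingFree A P) (hA : ¬ IsField A)
    {𝔪 : MaximalSpectrum A} {m n : ℕ} (hmn : m ≤ n) (h : P (cyclicPrimary 𝔪 n)) :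
    P (cyclicPrimary 𝔪 m) := by
  induction n, hmn using Nat.le_induction with
  | base => exact h
  | succ n _ ih => exact ih (hP.cyclicPrimary_of_succ hA h)

end IsRepleteReflectiveContainingFree

/-! ### Exponent functions and the classification -/

section Classification

variable {A : Type u} [CommRing A]

/-- The full subcategory of the modules bounded by `f`. -/
def primaryBounded (f : MaximalSpectrum A → ℕ∞) : ObjectProperty (FGModuleCat.{u} A) :=
  fun M => IsPrimaryBounded f M

/-- The supremum of the exponents `n` for which `A / 𝔪 ^ n` belongs to the subcategory. -/
noncomputable def primaryExponent (P : ObjectProperty (FGModuleCat.{u} A))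
    (𝔪 : MaximalSpectrum A) : ℕ∞ :=
  ⨆ (n : ℕ) (_ : P (cyclicPrimary 𝔪 n)), (n : ℕ∞)

theorem epi_ofHom_of_surjective {M Q : Type u} [AddCommGroup M] [Module A M] [Module.Finite A M]
    [AddCommGroup Q] [Module A Q] [Module.Finite A Q] (q : M →ₗ[A] Q) (hq : Function.Surjective q) :
    Epi (FGModuleCat.ofHom q) where
  left_cancellation h h' e := FGModuleCat.hom_ext <| LinearMap.ext fun y => by
    obtain ⟨x, rfl⟩ := hq y
    exact congrArg (fun g => g.hom.hom x) e

variable [IsDedekindDomain A] {P : ObjectProperty (FGModuleCat.{u} A)}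

/-- The exponents of the cyclic members form an initial segment of `ℕ`, so the supremum loses no
information. -/
theorem le_primaryExponent_iff (hP : IsRepleteReflectiveContainingFree A P) (hA : ¬ IsField A)
    {𝔪 : MaximalSpectrum A} {n : ℕ} :
    (n : ℕ∞) ≤ primaryExponent P 𝔪 ↔ P (cyclicPrimary 𝔪 n) := by
  refine ⟨fun h => ?_, fun h => le_iSup₂_of_le n h le_rfl⟩
  rcases n with - | n
  -- `A / 𝔪 ^ 0` is the zero module, which is free
  · have : Subsingleton (A ⧸ 𝔪.asIdeal ^ 0) :=
      Ideal.Quotient.subsingleton_iff.2 (by rw [pow_zero, Ideal.one_eq_top])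
    exact hP.free_mem _ (inferInstanceAs (Module.Free A (A ⧸ 𝔪.asIdeal ^ 0)))
  · have hlt : (n : ℕ∞) < primaryExponent P 𝔪 :=
      lt_of_lt_of_le (Nat.cast_lt.2 n.lt_succ_self) h
    obtain ⟨m, hm⟩ := lt_iSup_iff.1 hlt
    obtain ⟨hm, hnm⟩ := lt_iSup_iff.1 hm
    exact hP.cyclicPrimary_of_le hA (Nat.succ_le_of_lt (Nat.cast_lt.1 hnm)) hm

/-- A subcategory is determined by its cyclic members: a module is a finite product of retracts of
free modules and of cyclic modules, and the latter are its own retracts. -/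
theorem primaryBounded_primaryExponent (hP : IsRepleteReflectiveContainingFree A P)
    (hA : ¬ IsField A) : primaryBounded (primaryExponent P) = P := by
  ext M
  obtain ⟨Q, _, _, _, _, r, 𝔪, ε, ⟨φ⟩⟩ := exists_linearEquiv_projective_prod_pi (A := A) M
  constructor
  · intro hM
    have hbd := (IsPrimaryBounded.of_injective hM _ φ.symm.injective).exponent_le
    refine hP.of_linearEquiv φ.symm (hP.of_prod hP.of_projective (hP.of_pi fun i => ?_))
    exact (le_primaryExponent_iff hP hA).1 (hbd i)
  · rintro hM 𝔫 n ⟨g, hg⟩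
    rcases eq_or_ne n 0 with rfl | hn
    · simp
    obtain ⟨i, rfl, hi⟩ := exists_le_exponent_of_injective hA hn (φ.toLinearMap ∘ₗ g)
      (φ.injective.comp hg)
    refine (Nat.cast_le.2 hi).trans ((le_primaryExponent_iff hP hA).2 ?_)
    refine hP.of_retract (cyclicInclusion Q 𝔪 ε i) (LinearMap.proj i ∘ₗ LinearMap.snd A Q _)
      (LinearMap.ext fun x => ?_) (hP.of_linearEquiv φ hM)
    exact Pi.single_eq_same (M := fun j => A ⧸ (𝔪 j).asIdeal ^ ε j) i x

theorem primaryExponent_primaryBounded (hA : ¬ IsField A) {f : MaximalSpectrum A → ℕ∞}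
    (hf : IsRepleteReflectiveContainingFree A (primaryBounded f)) :
    primaryExponent (primaryBounded f) = f :=
  funext fun _ => ENat.eq_of_forall_natCast_le_iff fun _ =>
    (le_primaryExponent_iff hf hA).trans (isPrimaryBounded_quotient_pow_iff hA)

section Reflection

variable {f : MaximalSpectrum A → ℕ∞} {M Q : Type u} [AddCommGroup M] [Module A M]
  [Module.Finite A M] [AddCommGroup Q] [Module A Q] [Module.Finite A Q]

/-- A surjection whose kernel is the excess torsion is universal among the maps to bounded
modules. -/
theorem exists_comp_eq_of_ker_eq_excessTorsion (hA : ¬ IsField A) (q : M →ₗ[A] Q)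
    (hq : Function.Surjective q) (hker : LinearMap.ker q = excessTorsion f M)
    (N : FGModuleCat.{u} A) (hN : primaryBounded f N) (g : FGModuleCat.of A M ⟶ N) :
    ∃ h : FGModuleCat.of A Q ⟶ N, FGModuleCat.ofHom q ≫ h = g := by
  have hle : LinearMap.ker q ≤ LinearMap.ker g.hom.hom :=
    hker.le.trans (excessTorsion_le_ker hA hN g.hom.hom)
  refine ⟨FGModuleCat.ofHom ((LinearMap.ker q).liftQ g.hom.hom hle ∘ₗ
    (q.quotKerEquivOfSurjective hq).symm.toLinearMap),
    FGModuleCat.hom_ext (LinearMap.ext fun x => ?_)⟩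
  have h : (q.quotKerEquivOfSurjective hq).symm (q x) = Submodule.Quotient.mk x := by
    rw [LinearEquiv.symm_apply_eq]; rfl
  exact congrArg ((LinearMap.ker q).liftQ g.hom.hom hle) h

theorem exists_reflector_iso (hA : ¬ IsField A)
    {L : FGModuleCat.{u} A ⥤ (primaryBounded f).FullSubcategory} (adj : L ⊣ (primaryBounded f).ι)
    (q : M →ₗ[A] Q) (hq : Function.Surjective q) (hker : LinearMap.ker q = excessTorsion f M)
    (hQ : IsPrimaryBounded f Q) :
    ∃ i : (L.obj (FGModuleCat.of A M)).obj ≅ FGModuleCat.of A Q,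
      adj.unit.app (FGModuleCat.of A M) ≫ i.hom = FGModuleCat.ofHom q :=
  have := epi_ofHom_of_surjective q hq
  adj.exists_iso_of_universal (Q := FGModuleCat.of A Q) hQ _ (exists_comp_eq_of_ker_eq_excessTorsion hA q hq hker)

end Reflection

/-- The reflector sends `M` to `M ⧸ excessTorsion f M`. -/
theorem isRightAdjoint_primaryBounded_ι (hA : ¬ IsField A) (f : MaximalSpectrum A → ℕ∞) :
    (primaryBounded f).ι.IsRightAdjoint := by
  let F : FGModuleCat.{u} A → (primaryBounded f).FullSubcategory := fun M =>
    ⟨FGModuleCat.of A (M ⧸ excessTorsion f M), isPrimaryBounded_quotient_excessTorsion hA f M⟩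
  let q : (M : FGModuleCat.{u} A) → (M ⟶ (F M).obj) := fun M =>
    FGModuleCat.ofHom (excessTorsion f M).mkQ
  have hbij : ∀ (M : FGModuleCat.{u} A) (N : (primaryBounded f).FullSubcategory),
      Function.Bijective fun h : F M ⟶ N => q M ≫ h.hom := fun M N => by
    have : Epi (q M) := epi_ofHom_of_surjective _ (Submodule.mkQ_surjective _)
    refine ⟨fun h h' e => ObjectProperty.hom_ext _ ((cancel_epi (q M)).1 e), fun g => ?_⟩
    obtain ⟨h, hh⟩ := exists_comp_eq_of_ker_eq_excessTorsion hA (excessTorsion f M).mkQ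
      (Submodule.mkQ_surjective _) (Submodule.ker_mkQ _) N.obj N.property g
    exact ⟨ObjectProperty.homMk h, hh⟩
  let e : (M : FGModuleCat.{u} A) → (N : (primaryBounded f).FullSubcategory) →
      (F M ⟶ N) ≃ (M ⟶ (primaryBounded f).ι.obj N) := fun M N => Equiv.ofBijective _ (hbij M N)
  exact ⟨_, ⟨Adjunction.adjunctionOfEquivLeft e
    fun M N N' g h => (Category.assoc (q M) h.hom g.hom).symm⟩⟩

theorem isRepleteReflectiveContainingFree_primaryBounded (hA : ¬ IsField A)
    (f : MaximalSpectrum A → ℕ∞) : IsRepleteReflectiveContainingFree A (primaryBounded f) where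
  replete := ⟨fun i h => IsPrimaryBounded.of_injective h
    (FGModuleCat.isoToLinearEquiv i).symm.toLinearMap
    (FGModuleCat.isoToLinearEquiv i).symm.injective⟩
  reflective := isRightAdjoint_primaryBounded_ι hA f
  free_mem M _ := (isPrimaryBounded_prod_pi hA M (r := 0) (𝔪 := finZeroElim) (ε := finZeroElim)
    finZeroElim).of_injective (LinearMap.inl A M _) LinearMap.inl_injective

/-- The isomorphism sending a subcategory to its exponent function, with inverse sending a function
to the subcategory of the modules bounded by it. -/
noncomputable def subcategoryOrderIso (hA : ¬ IsField A) :
    RepleteReflectiveSubcategory A ≃o (MaximalSpectrum A → ℕ∞) where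
  toFun 𝒜 := primaryExponent 𝒜.1
  invFun f := ⟨primaryBounded f, isRepleteReflectiveContainingFree_primaryBounded hA f⟩
  left_inv 𝒜 := Subtype.ext (primaryBounded_primaryExponent 𝒜.2 hA)
  right_inv f := primaryExponent_primaryBounded hA
    (isRepleteReflectiveContainingFree_primaryBounded hA f)
  map_rel_iff' {𝒜 ℬ} := by
    refine ⟨fun h => ?_, fun h 𝔪 => iSup₂_le fun n hn => le_iSup₂_of_le n (h _ hn) le_rfl⟩
    change 𝒜.1 ≤ ℬ.1
    rw [← primaryBounded_primaryExponent 𝒜.2 hA, ← primaryBounded_primaryExponent ℬ.2 hA]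
    exact fun M hM 𝔪 n hg => (hM 𝔪 n hg).trans (h 𝔪)

end Classification

theorem mainTheorem5 (A : Type u) [CommRing A] [IsDedekindDomain A] (hA : ¬ IsField A) :
    ∃ e : RepleteReflectiveSubcategory A ≃o (MaximalSpectrum A → ℕ∞),
      -- `e 𝒜 𝔪` is the largest `n` with `A / 𝔪 ^ n` in `𝒜`, or `∞` if all of them are in `𝒜`
      (∀ (𝒜 : RepleteReflectiveSubcategory A) (𝔪 : MaximalSpectrum A),
        (∀ k : ℕ, e 𝒜 𝔪 = (k : ℕ∞) ↔
          IsGreatest {n : ℕ | 𝒜.1 (cyclicPrimary 𝔪 n)} k) ∧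
        (e 𝒜 𝔪 = ⊤ ↔ ∀ n : ℕ, 𝒜.1 (cyclicPrimary 𝔪 n))) ∧
      -- the subcategory with function `f` consists of the modules `M` such that `A / 𝔪 ^ n`
      -- embeds in `M` only if `n ≤ f 𝔪`
      (∀ (f : MaximalSpectrum A → ℕ∞) (M : FGModuleCat.{u} A),
        (e.symm f).1 M ↔
          ∀ (𝔪 : MaximalSpectrum A) (n : ℕ),
            (∃ g : (A ⧸ 𝔪.asIdeal ^ n) →ₗ[A] M, Function.Injective g) → (n : ℕ∞) ≤ f 𝔪) ∧
      -- every reflector truncates the torsion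
      (∀ (f : MaximalSpectrum A → ℕ∞)
        (L : FGModuleCat.{u} A ⥤ (e.symm f).1.FullSubcategory) (adj : L ⊣ (e.symm f).1.ι),
        (∀ M : FGModuleCat.{u} A,
          ∃ i : (L.obj M).obj ≅ FGModuleCat.of A (M ⧸ excessTorsion f M),
            adj.unit.app M ≫ i.hom = FGModuleCat.ofHom (excessTorsion f M).mkQ) ∧
        (∀ (P : Type u) [AddCommGroup P] [Module A P] [Module.Finite A P] [Module.Projective A P]
          (r : ℕ) (𝔪 : Fin r → MaximalSpectrum A) (ε : Fin r → ℕ),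
          ∃ i : (L.obj (FGModuleCat.of A
                (P × ((j : Fin r) → A ⧸ (𝔪 j).asIdeal ^ ε j)))).obj ≅
              FGModuleCat.of A
                (P × ((j : Fin r) → A ⧸ (𝔪 j).asIdeal ^ truncExponent f (𝔪 j) (ε j))),
            adj.unit.app (FGModuleCat.of A
                (P × ((j : Fin r) → A ⧸ (𝔪 j).asIdeal ^ ε j))) ≫ i.hom =
              FGModuleCat.ofHom (truncProjection f P 𝔪 ε))) := by
  refine ⟨subcategoryOrderIso hA, fun 𝒜 𝔪 => ?_, fun f M => Iff.rfl, fun f L adj => ⟨?_, ?_⟩⟩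
  · have hle (n : ℕ) : (n : ℕ∞) ≤ subcategoryOrderIso hA 𝒜 𝔪 ↔ 𝒜.1 (cyclicPrimary 𝔪 n) :=
      le_primaryExponent_iff 𝒜.2 hA
    refine ⟨fun k => ⟨fun h => ⟨(hle k).1 h.ge, fun n hn => ?_⟩, fun h => ?_⟩, ?_⟩
    · exact Nat.cast_le.1 (((hle n).2 hn).trans h.le)
    · refine ENat.eq_of_forall_natCast_le_iff fun n => (hle n).trans ⟨fun hn => ?_, fun hn => ?_⟩
      · exact Nat.cast_le.2 (h.2 hn)
      · exact 𝒜.2.cyclicPrimary_of_le hA (Nat.cast_le.1 hn) h.1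
    · simp only [ENat.eq_top_iff_forall_ge, hle]
  · exact fun M => exists_reflector_iso hA adj _ (Submodule.mkQ_surjective _)
      (Submodule.ker_mkQ _) (isPrimaryBounded_quotient_excessTorsion hA f M)
  · intro P _ _ _ _ r 𝔪 ε
    exact exists_reflector_iso hA adj _ (truncProjection_surjective P 𝔪 ε f)
      (ker_truncProjection f P 𝔪 ε hA) (isPrimaryBounded_truncProjection_target f P 𝔪 ε hA)
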